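/- All algebras are nonempty and of one fixed finite similarity type (finitely many operation symbols, each of finite arity). A variety is a class of algebras closed under homomorphic images, (isomorphic copies of) subalgebras and direct products; a quasivariety is a class closed under (isomorphic copies of) subalgebras, direct products and ultraproducts. The empty direct product, a one-element algebra, is included among direct products. A variety $V$ is a discriminator variety if it is generated, as a variety, by some class $K$ of algebras for which there is a term $t(x,y,z)$ such that for every $A\in K$ and all $a,b,c\in A$ one has $t(a,b,c)=a$ if $a\neq b$ and $t(a,b,c)=c$ if $a=b$. An algebra is minimal if it has more than one element and has no proper subalgebra. For a variety $W$, let $F_W(\omega)$ be the free algebra of $W$ of countably infinite rank, and let $Q_W$ be the quasivariety generated by $F_W(\omega)$. A quasivariety $Q$ is primitive if for every quasivariety $Q_0\subseteq Q$ there is a variety $W$ with $Q_0=Q\cap W$. Corollary. Let $V$ be a discriminator variety that contains a finite minimal algebra $M$ which embeds in every nontrivial algebra of $V$. Let $Q\subseteq V$ be a quasivariety. Then $Q$ is primitive if and only if $Q=Q_{V'}$ for some variety $V'\subseteq V$. -/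

import Mathlib

universe u v

open scoped FirstOrder

namespace UnivAlg

/-- A (nonempty) algebra of similarity type `L`. The type `L` is an algebraic first-order language,
i.e. one without relation symbols (`L.IsAlgebraic` is a hypothesis wherever it matters). -/
structure Alg (L : FirstOrder.Language.{u, v}) where
  carrier : Type u
  [str : L.Structure carrier]
  [nonempty : Nonempty carrier]

instance (L : FirstOrder.Language.{u, v}) : CoeSort (Alg L) (Type u) := ⟨Alg.carrier⟩

attribute [instance] Alg.str Alg.nonempty

variable {L : FirstOrder.Language.{u, v}}

/-- The direct product with coordinatewise operations (one-element if the index type is empty). -/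
def Alg.pi {I : Type u} (A : I → Alg L) : Alg L :=
  letI : L.Structure (∀ i, A i) :=
    { funMap := fun f x i => FirstOrder.Language.Structure.funMap f fun j => x j i
      RelMap := fun r x => ∀ i, FirstOrder.Language.Structure.RelMap r fun j => x j i }
  { carrier := ∀ i, A i }

/-- The ultraproduct of a family of algebras. -/
def Alg.ultraproduct {I : Type u} (U : Ultrafilter I) (A : I → Alg L) : Alg L :=
  haveI : Nonempty ((U : Filter I).Product fun i => (A i : Type u)) :=
    ⟨Quotient.mk _ fun i => Classical.arbitrary (A i)⟩
  { carrier := (U : Filter I).Product fun i => (A i : Type u) }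

/-- Closure under homomorphic images (in particular under isomorphic copies). -/
def ClosedH (K : Set (Alg L)) : Prop :=
  ∀ A ∈ K, ∀ (B : Alg L) (f : A →[L] B), Function.Surjective f → B ∈ K

/-- Closure under isomorphic copies of subalgebras. -/
def ClosedS (K : Set (Alg L)) : Prop :=
  ∀ A ∈ K, ∀ B : Alg L, Nonempty (B ↪[L] A) → B ∈ K

/-- Closure under direct products. -/
def ClosedP (K : Set (Alg L)) : Prop :=
  ∀ (I : Type u) (A : I → Alg L), (∀ i, A i ∈ K) → Alg.pi A ∈ K

/-- Closure under ultraproducts. -/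
def ClosedPU (K : Set (Alg L)) : Prop :=
  ∀ (I : Type u) (U : Ultrafilter I) (A : I → Alg L), (∀ i, A i ∈ K) →
    Alg.ultraproduct U A ∈ K

/-- A variety: a class of algebras closed under `H`, `S` and `P`. -/
structure IsVariety (V : Set (Alg L)) : Prop where
  closedH : ClosedH V
  closedS : ClosedS V
  closedP : ClosedP V

/-- A quasivariety: a class of algebras closed under `S`, `P` and `P_U`. -/
structure IsQuasivariety (Q : Set (Alg L)) : Prop where
  closedS : ClosedS Q
  closedP : ClosedP Q
  closedPU : ClosedPU Q

/-- The variety generated by `K`: the intersection of all varieties that contain `K`. -/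
def varietyGenerated (K : Set (Alg L)) : Set (Alg L) :=
  {A | ∀ W : Set (Alg L), IsVariety W → K ⊆ W → A ∈ W}

/-- The quasivariety generated by `K`: the intersection of all quasivarieties that contain `K`. -/
def quasivarietyGenerated (K : Set (Alg L)) : Set (Alg L) :=
  {A | ∀ W : Set (Alg L), IsQuasivariety W → K ⊆ W → A ∈ W}

/-- The ternary term `t` realizes the discriminator function on `A`. -/
def IsDiscriminatorTerm (t : L.Term (Fin 3)) (A : Alg L) : Prop :=
  ∀ a b c : A, (a ≠ b → t.realize ![a, b, c] = a) ∧ (a = b → t.realize ![a, b, c] = c)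

/-- A discriminator variety: a variety generated by a class of algebras with a common
discriminator term. -/
def IsDiscriminatorVariety (V : Set (Alg L)) : Prop :=
  IsVariety V ∧ ∃ K : Set (Alg L), varietyGenerated K = V ∧
    ∃ t : L.Term (Fin 3), ∀ A ∈ K, IsDiscriminatorTerm t A

/-- A minimal algebra: nontrivial and without proper (nonempty) subalgebras. -/
def IsMinimal (A : Alg L) : Prop :=
  Nontrivial A ∧ ∀ S : L.Substructure A, (S : Set A).Nonempty → S = ⊤

/-- Terms in countably many variables, identified when the identity `s ≈ t` holds in `V`. -/
def termSetoid (V : Set (Alg L)) : Setoid (L.Term ℕ) where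
  r s t := ∀ A ∈ V, ∀ x : ℕ → A, s.realize x = t.realize x
  iseqv :=
    { refl := fun _ _ _ _ => rfl
      symm := fun h A hA x => (h A hA x).symm
      trans := fun h k A hA x => (h A hA x).trans (k A hA x) }

/-- The term algebra, with the congruence of identities of `V`. -/
instance termPrestructure (V : Set (Alg L)) : L.Prestructure (termSetoid V) where
  toStructure :=
    { funMap := fun f x => FirstOrder.Language.Term.func f x
      RelMap := fun _ _ => False }
  fun_equiv := fun {_} f _ _ h A hA z =>
    congrArg (FirstOrder.Language.Structure.funMap f) (funext fun i => h i A hA z)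
  rel_equiv := fun _ _ _ => rfl

/-- The free algebra of countably infinite rank of `V`. -/
def freeAlg (V : Set (Alg L)) : Alg L :=
  haveI : Nonempty (Quotient (termSetoid V)) := ⟨Quotient.mk _ (FirstOrder.Language.Term.var 0)⟩
  { carrier := Quotient (termSetoid V) }

/-- The quasivariety `Q_V` generated by the free algebra of countably infinite rank of `V`. -/
def freeQuasivariety (V : Set (Alg L)) : Set (Alg L) :=
  quasivarietyGenerated {freeAlg V}

/-- A quasivariety is primitive if each of its subquasivarieties is its intersection with some
variety. -/
def IsPrimitive (Q : Set (Alg L)) : Prop :=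
  IsQuasivariety Q ∧ ∀ Q₀ : Set (Alg L), IsQuasivariety Q₀ → Q₀ ⊆ Q →
    ∃ W : Set (Alg L), IsVariety W ∧ Q₀ = Q ∩ W

end UnivAlg

namespace UnivAlg

universe w

open FirstOrder.Language Filter

variable {L : FirstOrder.Language.{u, v}}

/-! If `Q` is primitive, let F be the free algebra of the variety generated by `Q`. F lies in `Q`,
and a variety cutting out the quasivariety of F inside `Q` contains F, hence all of `Q`; so `Q` is
generated by F (`IsPrimitive.eq_freeQuasivariety`).

The converse rests on `freeQuasivariety_eq_trivialOrHomTo`: Q_{V'} consists of the members of V'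
that are trivial or map to M. These form a quasivariety because M is finite. Conversely, a
nontrivial A with a map to M gets a map y : A → M → F. Choose φ : F → A covering a given finite part
of A, and a section g of φ there. If g violates one table entry, with sides p and q, replace each g
a by "g a if p = q, else y a", written as a term of the discriminator. Since φ p = φ q, this is
still a section; the entry is repaired and no other is spoilt. Thus A embeds in an ultrapower of F.

The condition of mapping to M does not depend on V', so a quasivariety below Q_{V'} is cut out by
the variety it generates. -/

/-! ### Identities -/

/-- The identity `s ≈ t` holds in the algebra `A`. -/
def Alg.Satisfies (A : Alg L) {X : Type w} (s t : L.Term X) : Prop :=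
  ∀ x : X → A, s.realize x = t.realize x

theorem Alg.realize_pi {I : Type u} (A : I → Alg L) {X : Type w} (s : L.Term X)
    (x : X → Alg.pi A) (i : I) :
    (s.realize x : Alg.pi A) i = s.realize (fun j => (x j i : A i)) := by
  induction s with
  | var => rfl
  | func f ts ih =>
    change Structure.funMap f (fun j => ((ts j).realize x : Alg.pi A) i) = _
    simp only [ih, Term.realize]

theorem realize_congr {A : Type*} [L.Structure A] {X : Type w} [DecidableEq X] (s : L.Term X)
    {x y : X → A} (h : ∀ a ∈ s.varFinset, x a = y a) : s.realize x = s.realize y := by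
  have key (z : X → A) := Term.realize_restrictVar' (M := A)
    (subset_refl (s.varFinset : Set X)) (v := z)
  rw [← key x, ← key y]
  congr 1
  funext a
  exact h a a.2

/-- A map that commutes with the operations, as a homomorphism. -/
def mkHom [L.IsAlgebraic] {A B : Type*} [L.Structure A] [L.Structure B] (f : A → B)
    (h : ∀ {n} (g : L.Functions n) (x : Fin n → A),
      f (Structure.funMap g x) = Structure.funMap g (f ∘ x)) : A →[L] B where
  toFun := f
  map_fun' := h
  map_rel' r := isEmptyElim r

theorem ClosedS.mem_of_injective [L.IsAlgebraic] {K : Set (Alg L)} (hK : ClosedS K) {A B : Alg L} (hA : A ∈ K)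
    (f : B →[L] A) (hf : Function.Injective f) : B ∈ K :=
  hK A hA B ⟨Embedding.ofInjective hf⟩

/-- The coordinate projection of a direct product. -/
def projHom [L.IsAlgebraic] {I : Type u} (A : I → Alg L) (i : I) : Alg.pi A →[L] A i :=
  mkHom (fun x => x i) fun _ _ => rfl

/-- The homomorphism into a direct product with given coordinates. -/
def piHom [L.IsAlgebraic] {I : Type u} {B : Alg L} (A : I → Alg L)
    (f : ∀ i, B →[L] A i) : B →[L] Alg.pi A :=
  mkHom (fun b i => f i b) fun g x => funext fun i => (f i).map_fun g x

theorem isVariety_satisfies {X : Type w} (s t : L.Term X) :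
    IsVariety {A : Alg L | A.Satisfies s t} where
  closedH A hA B f hf x := by
    obtain ⟨y, rfl⟩ : ∃ y : X → A, x = f ∘ y :=
      ⟨fun i => (hf (x i)).choose, funext fun i => (hf (x i)).choose_spec.symm⟩
    rw [HomClass.realize_term, HomClass.realize_term, hA y]
  closedS A hA B := fun ⟨f⟩ x => f.injective <| by
    rw [← HomClass.realize_term, ← HomClass.realize_term, hA]
  closedP I A hA x := by
    refine funext fun i => ?_
    rw [Alg.realize_pi, Alg.realize_pi, hA i]

theorem isVariety_varietyGenerated (K : Set (Alg L)) : IsVariety (varietyGenerated K) where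
  closedH A hA B f hf W hW hK := hW.closedH A (hA W hW hK) B f hf
  closedS A hA B hf W hW hK := hW.closedS A (hA W hW hK) B hf
  closedP I A hA W hW hK := hW.closedP I A fun i => hA i W hW hK

theorem isQuasivariety_quasivarietyGenerated (K : Set (Alg L)) :
    IsQuasivariety (quasivarietyGenerated K) where
  closedS A hA B hf W hW hK := hW.closedS A (hA W hW hK) B hf
  closedP I A hA W hW hK := hW.closedP I A fun i => hA i W hW hK
  closedPU I U A hA W hW hK := hW.closedPU I U A fun i => hA i W hW hK

theorem subset_varietyGenerated (K : Set (Alg L)) : K ⊆ varietyGenerated K :=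
  fun _ hA _ _ hK => hK hA

theorem satisfies_of_mem_varietyGenerated [L.IsAlgebraic] {K : Set (Alg L)}
    {X : Type w} {s t : L.Term X}
    (h : ∀ A ∈ K, A.Satisfies s t) {A : Alg L} (hA : A ∈ varietyGenerated K) :
    A.Satisfies s t :=
  hA _ (isVariety_satisfies s t) h

theorem ClosedP.mem_of_subsingleton [L.IsAlgebraic] {K : Set (Alg L)} (hP : ClosedP K)
    (hS : ClosedS K)
    (A : Alg L) [Subsingleton A] : A ∈ K := by
  have h := hP PEmpty (fun i => i.elim) (fun i => i.elim)
  exact hS.mem_of_injective h (piHom _ fun i => i.elim) (Function.injective_of_subsingleton _)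

/-! ### Generic elements and free algebras -/

/-- A class closed under products contains an algebra with elements `x` that satisfy only those
equations which are identities of the class. -/
theorem ClosedP.exists_generic {K : Set (Alg L)} (hP : ClosedP K) (X : Type w)
    [Small.{u} (L.Term X)] :
    ∃ B ∈ K, ∃ x : X → B, ∀ s t : L.Term X, s.realize x = t.realize x →
      ∀ A ∈ K, A.Satisfies s t := by
  -- One factor for each equation that fails somewhere in `K`, so the product refutes all of them at
  -- once.
  let J := {p : L.Term X × L.Term X // ∃ A ∈ K, ¬ A.Satisfies p.1 p.2}
  have hJ (j : J) : ∃ A ∈ K, ∃ x : X → A, j.1.1.realize x ≠ j.1.2.realize x := by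
    obtain ⟨A, hA, h⟩ := j.2
    exact ⟨A, hA, not_forall.1 h⟩
  choose A hA x hx using hJ
  let e : J ≃ Shrink.{u} J := equivShrink J
  refine ⟨Alg.pi fun i => A (e.symm i), hP _ _ fun i => hA _, fun a i => x (e.symm i) a, ?_⟩
  intro s t hst
  by_contra h
  replace h : ∃ A ∈ K, ¬ A.Satisfies s t := by simpa only [not_forall, exists_prop] using h
  have H : ∀ j : J, s.realize (x j) = t.realize (x j) := e.symm.surjective.forall.2 fun i =>
    (Alg.realize_pi _ s _ i).symm.trans ((congrFun hst i).trans (Alg.realize_pi _ t _ i))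
  exact hx ⟨(s, t), h⟩ (H _)

/-- Birkhoff's theorem: a variety contains every algebra in which all its identities hold. -/
theorem IsVariety.mem_of_satisfies [L.IsAlgebraic] {W : Set (Alg L)} (hW : IsVariety W) (A : Alg L)
    (h : ∀ s t : L.Term A, (∀ B ∈ W, B.Satisfies s t) → s.realize id = (t.realize id : A)) :
    A ∈ W := by
  obtain ⟨B, hB, x, hx⟩ := hW.closedP.exists_generic (A : Type u)
  let S : L.Substructure B :=
    { carrier := Set.range fun s : L.Term A => s.realize x
      fun_mem := fun f y hy => by
        choose s hs using hy
        exact ⟨Term.func f s, congrArg _ (funext hs)⟩ }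
  have : Nonempty S := ⟨⟨_, Term.var (Classical.arbitrary A), rfl⟩⟩
  let C : Alg L := { carrier := S }
  have hC : C ∈ W := hW.closedS B hB C ⟨S.subtype⟩
  let τ : C → L.Term A := fun c => c.2.choose
  have hτ (c : C) : (τ c).realize x = c.1 := c.2.choose_spec
  -- The choice of term is immaterial: terms with equal value at the generic `x` form an identity of
  -- `W`, so `h` equates them in `A`.
  have key (c : C) (s : L.Term A) (hs : s.realize x = c.1) :
      ((τ c).realize id : A) = s.realize id :=
    h _ _ (hx _ _ ((hτ c).trans hs.symm))
  refine hW.closedH C hC A (mkHom (fun c => (τ c).realize id) fun f y => ?_) fun a => ?_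
  · exact key _ (Term.func f fun i => τ (y i)) (congrArg _ (funext fun i => hτ (y i)))
  · exact ⟨⟨_, Term.var a, rfl⟩, key _ (Term.var a) rfl⟩

/-- Identities in arbitrary variables follow from those in countably many variables. -/
theorem Alg.satisfies_of_countable {K : Set (Alg L)} {A : Alg L}
    (h : ∀ s t : L.Term ℕ, (∀ B ∈ K, B.Satisfies s t) → A.Satisfies s t) {X : Type w}
    {s t : L.Term X} (hst : ∀ B ∈ K, B.Satisfies s t) : A.Satisfies s t := by
  classical
  intro x
  obtain ⟨ρ, hρ⟩ : ∃ ρ : X → ℕ, Set.InjOn ρ (s.varFinset ∪ t.varFinset : Finset X) :=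
    Set.countable_iff_exists_injOn.1 (Finset.countable_toSet _)
  -- `Function.invFunOn` needs a point of `X`; without variables any assignment of ℕ serves.
  by_cases hX : Nonempty X
  swap
  · have : IsEmpty X := not_nonempty_iff.1 hX
    have := h (s.relabel ρ) (t.relabel ρ) (fun B hB y => by
      simpa only [Term.realize_relabel] using hst B hB _) fun _ => Classical.arbitrary A
    simp only [Term.realize_relabel] at this
    convert this using 2
  have hρ' := hρ.leftInvOn_invFunOn
  have := h (s.relabel ρ) (t.relabel ρ) (fun B hB y => by
    simpa only [Term.realize_relabel] using hst B hB _)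
    (x ∘ Function.invFunOn ρ (s.varFinset ∪ t.varFinset : Finset X))
  simp only [Term.realize_relabel] at this
  rw [realize_congr s (y := x), realize_congr t (y := x)] at this
  · exact this
  · exact fun a ha => congrArg x (hρ' (Finset.mem_coe.2 (Finset.mem_union_right _ ha)))
  · exact fun a ha => congrArg x (hρ' (Finset.mem_coe.2 (Finset.mem_union_left _ ha)))

theorem funMap_term (V : Set (Alg L)) {n : ℕ} (f : L.Functions n) (s : Fin n → L.Term ℕ) :
    Structure.funMap f (fun i => (Quotient.mk (termSetoid V) (s i) : freeAlg V)) =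
      (Quotient.mk (termSetoid V) (Term.func f s) : freeAlg V) :=
  funMap_quotient_mk' (termSetoid V) f s

/-- The free generators of the free algebra. -/
def freeVar (V : Set (Alg L)) (i : ℕ) : freeAlg V := Quotient.mk (termSetoid V) (Term.var i)

theorem realize_freeVar (V : Set (Alg L)) (s : L.Term ℕ) :
    s.realize (freeVar V) = (Quotient.mk (termSetoid V) s : freeAlg V) := by
  induction s with
  | var => rfl
  | func f ts ih =>
    rw [Term.realize, funext ih]
    exact funMap_term V f ts

/-- The homomorphism from the free algebra that extends an assignment of the generators. -/
def freeLift [L.IsAlgebraic] {V : Set (Alg L)} {A : Alg L}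
    (hA : ∀ s t : L.Term ℕ, (∀ B ∈ V, B.Satisfies s t) → A.Satisfies s t) (x : ℕ → A) :
    freeAlg V →[L] A :=
  mkHom (Quotient.lift (fun s : L.Term ℕ => s.realize x) fun s t h => hA s t h x) fun {n} f y => by
    obtain ⟨s, rfl⟩ : ∃ s : Fin n → L.Term ℕ, y = fun i => Quotient.mk (termSetoid V) (s i) :=
      ⟨fun i => (y i).out, funext fun i => (Quotient.out_eq (y i)).symm⟩
    exact congrArg (Quotient.lift (fun s : L.Term ℕ => s.realize x) fun s t h => hA s t h x)
      (funMap_term V f s)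

/-- A class closed under subalgebras and products contains the free algebra of every class that
has the same identities. -/
theorem freeAlg_mem [L.IsAlgebraic] {K V : Set (Alg L)} (hS : ClosedS K) (hP : ClosedP K)
    (hK : ∀ A ∈ K, ∀ s t : L.Term ℕ, (∀ B ∈ V, B.Satisfies s t) → A.Satisfies s t)
    (hV : ∀ A ∈ V, ∀ s t : L.Term ℕ, (∀ B ∈ K, B.Satisfies s t) → A.Satisfies s t) :
    freeAlg V ∈ K := by
  have : Small.{u} (L.Term ℕ) := small_self _
  obtain ⟨B, hB, x, hx⟩ := hP.exists_generic ℕ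
  refine hS.mem_of_injective hB (freeLift (hK B hB) x) fun a b => ?_
  induction a, b using Quotient.inductionOn₂ with
  | _ s t => exact fun h => Quotient.sound fun A hA => hV A hA s t (hx s t h)

theorem IsVariety.freeAlg_mem [L.IsAlgebraic] {V : Set (Alg L)}
    (hV : IsVariety V) : freeAlg V ∈ V :=
  UnivAlg.freeAlg_mem hV.closedS hV.closedP (fun A hA _ _ h => h A hA) fun A hA _ _ h => h A hA

theorem IsQuasivariety.freeAlg_mem [L.IsAlgebraic] {Q : Set (Alg L)} (hQ : IsQuasivariety Q) :
    freeAlg (varietyGenerated Q) ∈ Q :=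
  UnivAlg.freeAlg_mem hQ.closedS hQ.closedP
    (fun A hA _ _ h => h A (subset_varietyGenerated Q hA))
    fun _ hA _ _ h => satisfies_of_mem_varietyGenerated h hA

/-- Every variety that contains the free algebra of `V` contains `V`. -/
theorem IsVariety.subset_of_freeAlg_mem [L.IsAlgebraic] {W V : Set (Alg L)} (hW : IsVariety W)
    (h : freeAlg V ∈ W) : V ⊆ W := by
  refine fun A hA => hW.mem_of_satisfies A fun s t hst => ?_
  refine Alg.satisfies_of_countable (K := W) (fun s t hst => ?_) hst id
  have := hst _ h (freeVar V)
  rw [realize_freeVar, realize_freeVar] at this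
  exact Quotient.exact this A hA

theorem IsPrimitive.eq_freeQuasivariety [L.IsAlgebraic] {Q : Set (Alg L)} (hQ : IsPrimitive Q) :
    Q = freeQuasivariety (varietyGenerated Q) := by
  have hsub : freeQuasivariety (varietyGenerated Q) ⊆ Q := fun A hA =>
    hA Q hQ.1 (Set.singleton_subset_iff.2 hQ.1.freeAlg_mem)
  obtain ⟨W, hW, h⟩ := hQ.2 _ (isQuasivariety_quasivarietyGenerated _) hsub
  have hF : freeAlg (varietyGenerated Q) ∈ W :=
    Set.inter_subset_right (h.subset fun _ _ h => h rfl)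
  have hQW : Q ⊆ W := (subset_varietyGenerated Q).trans (hW.subset_of_freeAlg_mem hF)
  exact (h.trans (Set.inter_eq_left.2 hQW)).symm

/-! ### Ultraproducts -/

/-- An ultraproduct is a quotient of the direct product. -/
theorem IsVariety.closedPU [L.IsAlgebraic] {V : Set (Alg L)}
    (hV : IsVariety V) : ClosedPU V := fun I U A hA =>
  hV.closedH _ (hV.closedP I A hA) (Alg.ultraproduct U A)
    (mkHom (fun x : ∀ i, A i => (x : (U : Filter I).Product fun i => (A i : Type u)))
      fun f x => (Ultraproduct.funMap_cast f x).symm)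
    Quotient.mk_surjective

/-- If almost all factors map to a finite algebra `M`, then so does the ultraproduct. -/
theorem nonempty_hom_ultraproduct [L.IsAlgebraic] {I : Type u} (U : Ultrafilter I)
    (A : I → Alg L) (M : Alg L)
    [Finite M] (h : ∀ᶠ i in U, Nonempty (A i →[L] M)) :
    Nonempty (Alg.ultraproduct U A →[L] M) := by
  classical
  -- The default constant map is used only on a `U`-null set of indices.
  let g (i : I) : A i → M := if hi : Nonempty (A i →[L] M) then hi.some
    else fun _ => Classical.arbitrary M
  have hg : ∀ᶠ i in U, ∀ (n : ℕ) (f : L.Functions n) (x : Fin n → A i),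
      g i (Structure.funMap f x) = Structure.funMap f (g i ∘ x) := by
    filter_upwards [h] with i hi n f x
    simp only [g, dif_pos hi]
    exact hi.some.map_fun f x
  -- Finiteness of `M` enters here: exactly one of its elements is the value at `U`-almost all
  -- indices.
  have hx (x : ∀ i, A i) : ∃ m, ∀ᶠ i in U, g i (x i) = m :=
    Ultrafilter.eventually_exists_iff.1 (Eventually.of_forall fun i => ⟨_, rfl⟩)
  let F : (∀ i, A i) → M := fun x => (hx x).choose
  have hF (x : ∀ i, A i) : ∀ᶠ i in U, g i (x i) = F x := (hx x).choose_spec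
  have hF' (x : ∀ i, A i) (m : M) (hm : ∀ᶠ i in U, g i (x i) = m) : F x = m := by
    obtain ⟨i, h₁, h₂⟩ := ((hF x).and hm).exists
    exact h₁.symm.trans h₂
  let G : Alg.ultraproduct U A → M := Quotient.lift F fun x y hxy => hF' x _ <| by
    have hxy : ∀ᶠ i in U, x i = y i := hxy
    filter_upwards [hxy, hF y] with i h₁ h₂
    rw [h₁, h₂]
  refine ⟨mkHom G fun {n} f y => ?_⟩
  obtain ⟨x, rfl⟩ : ∃ x : Fin n → ∀ i, A i,
      y = fun j => ((x j : (U : Filter I).Product fun i => (A i : Type u))) :=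
    ⟨fun j => (y j).out, funext fun j => (Quotient.out_eq (y j)).symm⟩
  refine (congrArg G (Ultraproduct.funMap_cast f x)).trans (hF' _ _ ?_)
  filter_upwards [hg, eventually_all.2 fun j => hF (x j)] with i h₁ h₂
  rw [h₁]
  exact congrArg _ (funext h₂)

/-- The algebras of `V` that are trivial or have a homomorphism to `M`. -/
def trivialOrHomTo (V : Set (Alg L)) (M : Alg L) : Set (Alg L) :=
  {A | A ∈ V ∧ (Subsingleton A ∨ Nonempty (A →[L] M))}

/-- One nontrivial factor already gives a product its map to `M`; in an ultraproduct, `U` decides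
which alternative holds almost everywhere. -/
theorem isQuasivariety_trivialOrHomTo [L.IsAlgebraic] {V : Set (Alg L)} (hV : IsVariety V)
    (M : Alg L)
    [Finite M] : IsQuasivariety (trivialOrHomTo V M) where
  closedS A hA B := fun ⟨f⟩ => ⟨hV.closedS A hA.1 B ⟨f⟩, hA.2.imp
    (fun (_ : Subsingleton A) => f.injective.subsingleton) fun ⟨g⟩ => ⟨g.comp f.toHom⟩⟩
  closedP I A hA := by
    refine ⟨hV.closedP I A fun i => (hA i).1, ?_⟩
    by_cases h : ∀ i, Subsingleton (A i)
    · exact Or.inl ⟨fun x y => funext fun i => (h i).elim _ _⟩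
    · obtain ⟨i, hi⟩ := not_forall.1 h
      obtain ⟨f⟩ := (hA i).2.resolve_left hi
      exact Or.inr ⟨f.comp (projHom A i)⟩
  closedPU I U A hA := by
    refine ⟨hV.closedPU I U A fun i => (hA i).1, ?_⟩
    rcases Ultrafilter.eventually_or.1 (Eventually.of_forall (f := (U : Filter I))
      fun i => (hA i).2) with h | h
    · refine Or.inl ⟨fun x y => ?_⟩
      induction x, y using Quotient.inductionOn₂ with
      | _ x y =>
        refine Quotient.sound ?_
        change ∀ᶠ i in U, x i = y i
        filter_upwards [h] with i hi using hi.elim _ _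
    · exact Or.inr (nonempty_hom_ultraproduct U A M h)

/-! ### Switching terms -/

/-- The term operation `d(d(p,q,z), d(p,q,w), w)` of an algebra with ternary term `d`: it returns
`z` if `p = q` and `w` otherwise, whenever `d` is a discriminator term. -/
def Alg.switch (A : Alg L) (d : L.Term (Fin 3)) (p q z w : A) : A :=
  d.realize ![d.realize ![p, q, z], d.realize ![p, q, w], w]

/-- The switching term. -/
def switchTerm (d : L.Term (Fin 3)) {X : Type w} (p q z w : L.Term X) : L.Term X :=
  d.subst ![d.subst ![p, q, z], d.subst ![p, q, w], w]

theorem realize_switchTerm (A : Alg L) (d : L.Term (Fin 3)) {X : Type w} (p q z w : L.Term X)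
    (x : X → A) : (switchTerm d p q z w).realize x =
      A.switch d (p.realize x) (q.realize x) (z.realize x) (w.realize x) := by
  have h (a b c : L.Term X) : (d.subst ![a, b, c]).realize x =
      d.realize ![a.realize x, b.realize x, c.realize x] := by
    rw [Term.realize_subst]
    congr 1
    funext i
    fin_cases i <;> rfl
  rw [switchTerm, h, h, h, Alg.switch]

theorem IsDiscriminatorTerm.switch_self {d : L.Term (Fin 3)} {A : Alg L}
    (h : IsDiscriminatorTerm d A) (p z w : A) : A.switch d p p z w = z := by
  rw [Alg.switch, (h p p z).2 rfl, (h p p w).2 rfl]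
  by_cases hzw : z = w
  · rw [(h z w w).2 hzw, hzw]
  · rw [(h z w w).1 hzw]

theorem IsDiscriminatorTerm.switch_of_ne {d : L.Term (Fin 3)} {A : Alg L}
    (h : IsDiscriminatorTerm d A) {p q : A} (hpq : p ≠ q) (z w : A) : A.switch d p q z w = w := by
  rw [Alg.switch, (h p q z).1 hpq, (h p q w).1 hpq, (h p p w).2 rfl]

theorem Alg.switch_map {A B : Alg L} (d : L.Term (Fin 3)) (f : A →[L] B) (p q z w : A) :
    f (A.switch d p q z w) = B.switch d (f p) (f q) (f z) (f w) := by
  have h (a b c : A) : f (d.realize ![a, b, c]) = d.realize ![f a, f b, f c] := by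
    rw [← HomClass.realize_term]
    congr 1
    funext i
    fin_cases i <;> rfl
  rw [Alg.switch, h, h, h, Alg.switch]

/-- The identities of the switching operation that hold in every discriminator variety. -/
structure Alg.IsSwitch (A : Alg L) (d : L.Term (Fin 3)) : Prop where
  switch_self (p z w : A) : A.switch d p p z w = z
  switch_fst_snd (p q w : A) : A.switch d p q p w = A.switch d p q q w
  switch_funMap {n : ℕ} (f : L.Functions n) (p q : A) (z w : Fin n → A) :
    Structure.funMap f (fun i => A.switch d p q (z i) (w i)) =
      A.switch d p q (Structure.funMap f z) (Structure.funMap f w)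

/-- On `K`, the switch with `p`, `q` fixed is one of the two projections, which gives the three laws
there; being identities, they pass to the generated variety. -/
theorem isSwitch_of_mem_varietyGenerated [L.IsAlgebraic] {K : Set (Alg L)} {d : L.Term (Fin 3)}
    (hK : ∀ A ∈ K, IsDiscriminatorTerm d A) {A : Alg L} (hA : A ∈ varietyGenerated K) :
    A.IsSwitch d where
  switch_self p z w := by
    have := satisfies_of_mem_varietyGenerated (s := switchTerm d (Term.var (0 : Fin 3))
      (Term.var 0) (Term.var 1) (Term.var 2)) (t := Term.var 1)
      (fun B hB x => by
        rw [realize_switchTerm, (hK B hB).switch_self]) hA ![p, z, w]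
    rwa [realize_switchTerm] at this
  switch_fst_snd p q w := by
    have := satisfies_of_mem_varietyGenerated
      (s := switchTerm d (Term.var (0 : Fin 3)) (Term.var 1) (Term.var 0) (Term.var 2))
      (t := switchTerm d (Term.var 0) (Term.var 1) (Term.var 1) (Term.var 2))
      (fun B hB x => by
        simp only [realize_switchTerm, Term.realize_var]
        by_cases h : x 0 = x 1
        · rw [h]
        · rw [(hK B hB).switch_of_ne h, (hK B hB).switch_of_ne h]) hA ![p, q, w]
    rwa [realize_switchTerm, realize_switchTerm] at this
  switch_funMap {n} f p q z w := by
    let P : L.Term (Fin 2 ⊕ Fin n ⊕ Fin n) := Term.var (Sum.inl 0)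
    let R : L.Term (Fin 2 ⊕ Fin n ⊕ Fin n) := Term.var (Sum.inl 1)
    let Z (i : Fin n) : L.Term (Fin 2 ⊕ Fin n ⊕ Fin n) := Term.var (Sum.inr (Sum.inl i))
    let Y (i : Fin n) : L.Term (Fin 2 ⊕ Fin n ⊕ Fin n) := Term.var (Sum.inr (Sum.inr i))
    have := satisfies_of_mem_varietyGenerated
      (s := Term.func f fun i => switchTerm d P R (Z i) (Y i))
      (t := switchTerm d P R (Term.func f Z) (Term.func f Y))
      (fun B hB x => by
        simp only [realize_switchTerm, Term.realize_func]
        by_cases h : P.realize x = R.realize x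
        · simp only [h, (hK B hB).switch_self]
        · simp only [(hK B hB).switch_of_ne h]) hA (Sum.elim ![p, q] (Sum.elim z w))
    simp only [realize_switchTerm, Term.realize_func] at this
    exact this

/-! ### Local embeddings into the free algebra -/

/-- Finitely many instances of the operation tables of `A` can be lifted along a homomorphism
`φ : B →[L] A` with a partial section, provided that there is a homomorphism `A →[L] B`. -/
theorem exists_partial_lift [L.IsAlgebraic] {A B : Alg L} {d : L.Term (Fin 3)} (hA : A.IsSwitch d)
    (hB : B.IsSwitch d) (φ : B →[L] A) (y : A →[L] B) {S : Set A} (g₀ : A → B)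
    (hg₀ : ∀ a ∈ S, φ (g₀ a) = a) (E : Finset (Σ n, L.Functions n × (Fin n → A)))
    (hE : ∀ e ∈ E, (∀ i, e.2.2 i ∈ S) ∧ Structure.funMap e.2.1 e.2.2 ∈ S) :
    ∃ g : A → B, (∀ a ∈ S, φ (g a) = a) ∧
      ∀ e ∈ E, Structure.funMap e.2.1 (g ∘ e.2.2) = g (Structure.funMap e.2.1 e.2.2) := by
  classical
  induction E using Finset.induction_on with
  | empty => exact ⟨g₀, hg₀, by simp⟩
  | insert e E _ ih =>
    obtain ⟨g, hg, hgE⟩ := ih fun e' he' => hE e' (Finset.mem_insert_of_mem he')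
    obtain ⟨n, f, x⟩ := e
    obtain ⟨hx, hfx⟩ := hE ⟨n, f, x⟩ (Finset.mem_insert_self _ _)
    -- The two sides of the new table entry; `φ` identifies them.
    let p := Structure.funMap f (g ∘ x)
    let q := g (Structure.funMap f x)
    have hp : φ p = Structure.funMap f x := by
      rw [φ.map_fun]
      exact congrArg _ (funext fun i => hg _ (hx i))
    have hq : φ q = Structure.funMap f x := hg _ hfx
    have hop {m : ℕ} (f' : L.Functions m) (x' : Fin m → A) :
        Structure.funMap f' ((fun a => B.switch d p q (g a) (y a)) ∘ x') =
          B.switch d p q (Structure.funMap f' (g ∘ x')) (y (Structure.funMap f' x')) := by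
      rw [y.map_fun]
      exact hB.switch_funMap f' p q (g ∘ x') (y ∘ x')
    -- After `φ` the switch selects `g a`, so the section survives. By `hop` the new entry becomes
    -- `switch_fst_snd`, and the old ones are inherited from `g`.
    refine ⟨fun a => B.switch d p q (g a) (y a), fun a ha => ?_, fun e' he' => ?_⟩
    · rw [Alg.switch_map, hp, hq, hA.switch_self, hg a ha]
    · rw [hop]
      rcases Finset.mem_insert.1 he' with rfl | he'
      · exact hB.switch_fst_snd p q _
      · rw [hgE e' he']

/-- An algebra is embeddable into an ultrapower of `B` if every finite part of it is. -/
theorem exists_embedding_ultrapower [L.IsAlgebraic] (A B : Alg L)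
    (h : ∀ (T : Finset A) (E : Finset (Σ n, L.Functions n × (Fin n → A))), ∃ g : A → B,
      Set.InjOn g T ∧
      ∀ e ∈ E, Structure.funMap e.2.1 (g ∘ e.2.2) = g (Structure.funMap e.2.1 e.2.2)) :
    ∃ (I : Type u) (U : Ultrafilter I),
      Nonempty (A ↪[L] Alg.ultraproduct U fun _ : I => B) := by
  classical
  let I : Type u := Finset A × Finset (Σ n, L.Functions n × (Fin n → A))
  -- `U` contains every cone of finite parts above a given one, so each single requirement holds
  -- almost everywhere.
  let U : Ultrafilter I := Ultrafilter.of atTop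
  have hU {p : I → Prop} (i₀ : I) (hp : ∀ i, i₀ ≤ i → p i) : ∀ᶠ i in U, p i :=
    (Ultrafilter.of_le _) ((eventually_ge_atTop i₀).mono hp)
  choose g hg hgE using fun i : I => h i.1 i.2
  let G (a : A) : (U : Filter I).Product fun _ => (B : Type u) := ((fun i => g i a : I → B))
  refine ⟨I, U, ⟨Embedding.ofInjective (f := mkHom (B := Alg.ultraproduct U fun _ : I => B) G
    fun {n} f x => ?_) fun a b hab => ?_⟩⟩
  · refine Eq.trans (Quotient.sound ?_) (Ultraproduct.funMap_cast f fun j i => g i (x j)).symm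
    exact hU (∅, {⟨n, f, x⟩}) fun i hi => (hgE i _ (hi.2 (Finset.mem_singleton_self _))).symm
  · have hab : ∀ᶠ i in U, g i a = g i b := Quotient.exact hab
    obtain ⟨i, h₁, h₂⟩ := (hab.and (hU ({a, b}, ∅) fun _ hi => hi.1)).exists
    exact hg i (h₂ (by simp)) (h₂ (by simp)) h₁

theorem mem_freeQuasivariety_of_hom [L.IsAlgebraic] {V : Set (Alg L)} {d : L.Term (Fin 3)}
    (hd : ∀ A ∈ V, A.IsSwitch d) (hV : IsVariety V) {A : Alg L} (hA : A ∈ V)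
    (y : A →[L] freeAlg V) : A ∈ freeQuasivariety V := by
  classical
  have hF : freeAlg V ∈ freeQuasivariety V := fun _ _ h => h rfl
  have hQ : IsQuasivariety (freeQuasivariety V) := isQuasivariety_quasivarietyGenerated _
  obtain ⟨I, U, hU⟩ := exists_embedding_ultrapower A (freeAlg V) fun T E => by
    -- All elements involved in `T` and `E`; the arbitrary one makes `S` nonempty, so that it can be
    -- enumerated by `v`.
    let S : Set A := {Classical.arbitrary A} ∪ T ∪
      ⋃ e ∈ E, (Set.range e.2.2 ∪ {Structure.funMap e.2.1 e.2.2})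
    have hS : S.Countable := by
      refine (((Set.finite_singleton _).union T.finite_toSet).union
        (E.finite_toSet.biUnion fun e _ => ?_)).countable
      exact (Set.finite_range _).union (Set.finite_singleton _)
    obtain ⟨v, hv⟩ := hS.exists_eq_range ⟨_, Or.inl (Or.inl rfl)⟩
    -- Here `φ` sends the `i`th generator to `v i`, and the initial section picks a generator over
    -- each element of `S`.
    obtain ⟨g, hg, hgE⟩ := exists_partial_lift (hd A hA) (hd _ hV.freeAlg_mem)
      (freeLift (fun _ _ h => h A hA) v) y (S := S) (fun a => freeVar V (Function.invFun v a))
      (fun a ha => Function.invFun_eq (hv.subset ha)) E fun e he =>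
        ⟨fun i => Or.inr (Set.mem_biUnion he (Or.inl ⟨i, rfl⟩)),
          Or.inr (Set.mem_biUnion he (Or.inr rfl))⟩
    refine ⟨g, fun a ha b hb hab => ?_, hgE⟩
    rw [← hg a (Or.inl (Or.inr ha)), hab, hg b (Or.inl (Or.inr hb))]
  exact hQ.closedS _ (hQ.closedPU I U _ fun _ => hF) A hU

/-! ### The quasivariety of the free algebra and its primitivity -/

/-- The quasivariety of the free algebra consists of the trivial algebras and those that have a
homomorphism to the finite algebra `M` embedded in all nontrivial algebras. -/
theorem freeQuasivariety_eq_trivialOrHomTo [L.IsAlgebraic] {V : Set (Alg L)} {d : L.Term (Fin 3)}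
    (hd : ∀ A ∈ V, A.IsSwitch d) (hV : IsVariety V) (M : Alg L) [Finite M]
    (hM : ∀ A ∈ V, Nontrivial A → Nonempty (M ↪[L] A)) :
    freeQuasivariety V = trivialOrHomTo V M := by
  refine Set.Subset.antisymm (fun A hA => ?_) fun A hA => ?_
  · refine hA _ (isQuasivariety_trivialOrHomTo hV M) (Set.singleton_subset_iff.2 ?_)
    refine ⟨hV.freeAlg_mem, (subsingleton_or_nontrivial _).imp_right fun h => ?_⟩
    have hMV : M ∈ V := hV.closedS _ hV.freeAlg_mem M (hM _ hV.freeAlg_mem h)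
    exact ⟨freeLift (fun _ _ h => h M hMV) fun _ => Classical.arbitrary M⟩
  · rcases subsingleton_or_nontrivial A with h | h
    · have hQ : IsQuasivariety (freeQuasivariety V) := isQuasivariety_quasivarietyGenerated _
      exact hQ.closedP.mem_of_subsingleton hQ.closedS A
    · obtain ⟨f⟩ := hA.2.resolve_left (not_subsingleton_iff_nontrivial.2 h)
      have hF : Nontrivial (freeAlg V) := by
        by_contra hF
        rw [not_nontrivial_iff_subsingleton] at hF
        refine not_subsingleton_iff_nontrivial.2 h ⟨fun a b => ?_⟩
        -- Equality of two free generators would be an identity forcing `A` to be trivial.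
        have h01 : freeVar V 0 = freeVar V 1 := Subsingleton.elim _ _
        exact Quotient.exact h01 A hA.1 fun n => if n = 0 then a else b
      obtain ⟨e⟩ := hM _ hV.freeAlg_mem hF
      exact mem_freeQuasivariety_of_hom hd hV hA.1 (e.toHom.comp f)

/-- The description by maps to `M` applies both to `V` and to the variety generated by a
subquasivariety `Q`, whose free algebra lies in `Q`. -/
theorem isPrimitive_freeQuasivariety [L.IsAlgebraic] {V : Set (Alg L)} {d : L.Term (Fin 3)}
    (hd : ∀ A ∈ V, A.IsSwitch d) (hV : IsVariety V) (M : Alg L) [Finite M]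
    (hM : ∀ A ∈ V, Nontrivial A → Nonempty (M ↪[L] A)) : IsPrimitive (freeQuasivariety V) := by
  refine ⟨isQuasivariety_quasivarietyGenerated _, fun Q hQ hQF => ?_⟩
  have hVQ := isVariety_varietyGenerated Q
  refine ⟨_, hVQ, Set.Subset.antisymm
    (Set.subset_inter hQF (subset_varietyGenerated Q)) fun A ⟨hAF, hAQ⟩ => ?_⟩
  rw [freeQuasivariety_eq_trivialOrHomTo hd hV M hM] at hAF hQF
  have hsub : varietyGenerated Q ⊆ V := fun B hB => hB V hV fun C hC => (hQF hC).1
  have hA : A ∈ freeQuasivariety (varietyGenerated Q) := by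
    rw [freeQuasivariety_eq_trivialOrHomTo (fun B hB => hd B (hsub hB)) hVQ M
      fun B hB => hM B (hsub hB)]
    exact ⟨hAQ, hAF.2⟩
  exact hA Q hQ (Set.singleton_subset_iff.2 hQ.freeAlg_mem)

end UnivAlg

theorem mainTheorem5 {L : FirstOrder.Language.{u, v}} [L.IsAlgebraic]
    [Finite (Σ n, L.Functions n)]
    (V : Set (UnivAlg.Alg L)) (hV : UnivAlg.IsDiscriminatorVariety V)
    (hM : ∃ M ∈ V, Finite M ∧ UnivAlg.IsMinimal M ∧
      ∀ A ∈ V, Nontrivial A → Nonempty (M ↪[L] A))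
    (Q : Set (UnivAlg.Alg L)) (hQ : UnivAlg.IsQuasivariety Q) (hQV : Q ⊆ V) :
    UnivAlg.IsPrimitive Q ↔
      ∃ V' : Set (UnivAlg.Alg L), UnivAlg.IsVariety V' ∧ V' ⊆ V ∧
        Q = UnivAlg.freeQuasivariety V' := by

  obtain ⟨M, -, hfin, -, hM⟩ := hM
  obtain ⟨hV, K, rfl, d, hd⟩ := hV
  constructor
  · exact fun h => ⟨UnivAlg.varietyGenerated Q, UnivAlg.isVariety_varietyGenerated Q,
      fun A hA => hA _ hV hQV, h.eq_freeQuasivariety⟩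
  · rintro ⟨V', hV', hsub, rfl⟩
    exact UnivAlg.isPrimitive_freeQuasivariety
      (fun A hA => UnivAlg.isSwitch_of_mem_varietyGenerated hd (hsub hA)) hV' M
      fun A hA => hM A (hsub hA)
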